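/- Theorem 3 (Latent Dirichlet Allocation). Model. Let $\alpha\in\mathbb R^k$ ($k\ge 1$) have strictly positive entries, let $\alpha_0=\sum_{i=1}^k\alpha_i$, and let $O\in\mathbb R^{d\times k}$ be a matrix of rank $k$ (so $d\ge k$) each of whose columns $O_1,\dots,O_k$ is a probability distribution on $\{1,\dots,d\}$. The latent vector $h$ has the Dirichlet distribution with parameter $\alpha$, i.e. density $\frac{\Gamma(\alpha_0)}{\prod_i\Gamma(\alpha_i)}\prod_{i}h_i^{\alpha_i-1}$ on the probability simplex. Given $h$, independently for each $v=1,2,3,\dots$, a topic $z_v\in\{1,\dots,k\}$ is drawn from $h$, then a word in $\{1,\dots,d\}$ is drawn from the column $O_{z_v}$; $x_v\in\mathbb R^d$ is the one-hot encoding of that word. With $\mu=\mathbb E[x_1]$, set $$\mathrm{Pairs}_{\alpha_0}=\mathbb E[x_1x_2^\top]-\tfrac{\alpha_0}{\alpha_0+1}\mu\mu^\top,$$ $$\mathrm{Triples}_{\alpha_0}(\eta)=\mathbb E[x_1x_2^\top\langle\eta,x_3\rangle]-\tfrac{\alpha_0}{\alpha_0+2}\bigl(\mathbb E[x_1x_2^\top]\eta\mu^\top+\mu\eta^\top\mathbb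 E[x_1x_2^\top]+\langle\eta,\mu\rangle\mathbb E[x_1x_2^\top]\bigr)+\tfrac{2\alpha_0^2}{(\alpha_0+2)(\alpha_0+1)}\langle\eta,\mu\rangle\mu\mu^\top .$$ For a matrix $A$ with linearly independent columns write $A^+=(A^\top A)^{-1}A^\top$, and write $\vec 1$ for a vector of all ones. Algorithm. The input is $\theta\in\mathbb R^k$, $\mathrm{Pairs}_{\alpha_0}$ and $\mathrm{Triples}_{\alpha_0}$. (1) Find $U\in\mathbb R^{d\times k}$ with $\mathrm{Range}(U)=\mathrm{Range}(\mathrm{Pairs}_{\alpha_0})$. (2) Find $V\in\mathbb R^{k\times k}$ with $V^\top(U^\top\mathrm{Pairs}_{\alpha_0}U)V=I$ and set $W=UV$. (3) Compute a singular value decomposition of $W^\top\mathrm{Triples}_{\alpha_0}(W\theta)W$ and let $\Lambda$ be the set of its left singular vectors whose singular value is unique (of multiplicity one among the $k$ singular values). (4) Return the set $\widehat O=\bigl\{(W^+)^\top\lambda\,/\,(\vec 1^\top(W^+)^\top\lambda):\lambda\in\Lambda\bigr\}$. Claim. Every step of the algorithm can be carried out (in particular $W$ has linearly independent columns and the denominators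 in step 4 are nonzero), and: - (No false positives) For every $\theta\in\mathbb R^k$ and all choices made in steps 1--3, $\widehat O$ is a subset of the set $\{O_1,\dots,O_k\}$ of columns of $O$. - (Topic recovery) For every $U$ and $V$ as in steps 1 and 2 (chosen without reference to $\theta$), if $\theta$ is uniformly distributed on the unit sphere $S^{k-1}$, then with probability $1$, for every singular value decomposition in step 3, $\widehat O=\{O_1,\dots,O_k\}$. - (Parameter recovery) $\alpha=\alpha_0(\alpha_0+1)\,O^+\,\mathrm{Pairs}_{\alpha_0}\,(O^+)^\top\,\vec 1$. -/

import Mathlib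

open MeasureTheory Matrix

noncomputable section

namespace LDA

/-- The point `(1 - ∑ i, y i, y 0, …, y (m-1))` of the affine hyperplane of vectors in `ℝ^(m+1)`
with coordinate sum one, parametrized by its last `m` coordinates. -/
def simplexPoint {m : ℕ} (y : Fin m → ℝ) : Fin (m + 1) → ℝ :=
  Fin.cons (1 - ∑ i, y i) y

/-- The normalizing constant `Z(α) = (∏ i, Γ(α i)) / Γ(∑ i, α i)`. -/
def dirichletZ {k : ℕ} (α : Fin k → ℝ) : ℝ :=
  (∏ i, Real.Gamma (α i)) / Real.Gamma (∑ i, α i)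

/-- The Dirichlet distribution on the probability simplex of `ℝ^k`: its density with respect to
Lebesgue measure on the simplex (in the coordinates `simplexPoint`) is
`Z(α)⁻¹ * ∏ i, p i ^ (α i - 1)`. There is no Dirichlet distribution for `k = 0`, where the simplex
is empty; the value there is the zero measure. -/
def dirichlet : {k : ℕ} → (Fin k → ℝ) → Measure (Fin k → ℝ)
  | 0, _ => 0
  | m + 1, α =>
    (((volume : Measure (Fin m → ℝ)).restrict
        {y | simplexPoint y ∈ stdSimplex ℝ (Fin (m + 1))}).withDensity
      (fun y => ENNReal.ofReal ((dirichletZ α)⁻¹ * ∏ i, simplexPoint y i ^ (α i - 1)))).map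
      simplexPoint

/-- The latent Dirichlet allocation model. The topic mixture `h` is Dirichlet distributed; given
`h`, the pairs `(z v, w v)` of the topic and the word at position `v` are independent over `v`,
with `z v` drawn from `h` and then `w v` drawn from column `z v` of `O`. -/
structure IsModel {Ω : Type*} [MeasurableSpace Ω] (P : Measure Ω) {d k : ℕ}
    (α : Fin k → ℝ) (O : Matrix (Fin d) (Fin k) ℝ)
    (h : Ω → Fin k → ℝ) (z : ℕ → Ω → Fin k) (w : ℕ → Ω → Fin d) : Prop where
  measurable_h : Measurable h
  measurable_z : ∀ v, Measurable (z v)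
  measurable_w : ∀ v, Measurable (w v)
  law_h : P.map h = dirichlet α
  law_words : ∀ (n : ℕ) (B : Set (Fin k → ℝ)), MeasurableSet B →
    ∀ (i : Fin n → Fin k) (j : Fin n → Fin d),
      P {ω | h ω ∈ B ∧ ∀ v : Fin n, z v ω = i v ∧ w v ω = j v} =
        ∫⁻ p in B, ∏ v, ENNReal.ofReal (p (i v) * O (j v) (i v)) ∂(P.map h)

/-- The one-hot encoding of the word at position `v`. -/
def oneHot {Ω : Type*} {d : ℕ} (w : ℕ → Ω → Fin d) (v : ℕ) (ω : Ω) : Fin d → ℝ :=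
  Pi.single (w v ω) 1

section Moments

variable {Ω : Type*} [MeasurableSpace Ω] (P : Measure Ω) {d : ℕ} (x : ℕ → Ω → Fin d → ℝ)

/-- `μ = E[x₁]`; the observations `x₁, x₂, x₃, …` are `x 0, x 1, x 2, …`. -/
def mean : Fin d → ℝ := fun a => ∫ ω, x 0 ω a ∂P

/-- `E[x₁ x₂ᵀ]`. -/
def secondMoment : Matrix (Fin d) (Fin d) ℝ :=
  Matrix.of fun a b => ∫ ω, x 0 ω a * x 1 ω b ∂P

/-- `E[x₁ x₂ᵀ ⟨η, x₃⟩]`. -/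
def thirdMoment (η : Fin d → ℝ) : Matrix (Fin d) (Fin d) ℝ :=
  Matrix.of fun a b => ∫ ω, x 0 ω a * x 1 ω b * (η ⬝ᵥ x 2 ω) ∂P

/-- The modified second moment. -/
def pairs (α₀ : ℝ) : Matrix (Fin d) (Fin d) ℝ :=
  secondMoment P x - (α₀ / (α₀ + 1)) • vecMulVec (mean P x) (mean P x)

/-- The modified third moment, projected to a matrix. -/
def triples (α₀ : ℝ) (η : Fin d → ℝ) : Matrix (Fin d) (Fin d) ℝ :=
  thirdMoment P x η
    - (α₀ / (α₀ + 2)) •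
      (secondMoment P x * vecMulVec η (mean P x)
        + vecMulVec (mean P x) η * secondMoment P x
        + (η ⬝ᵥ mean P x) • secondMoment P x)
    + (2 * α₀ ^ 2 / ((α₀ + 2) * (α₀ + 1))) •
      ((η ⬝ᵥ mean P x) • vecMulVec (mean P x) (mean P x))

end Moments

section Algorithm

variable {d k : ℕ}

/-- The pseudo-inverse `A⁺ = (AᵀA)⁻¹Aᵀ` of a matrix with linearly independent columns. -/
def pinv (A : Matrix (Fin d) (Fin k) ℝ) : Matrix (Fin k) (Fin d) ℝ :=
  (Aᵀ * A)⁻¹ * Aᵀ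

/-- Step 1 (dimensionality reduction): `Range U = Range Pairs`. -/
def IsReduction (Pairs : Matrix (Fin d) (Fin d) ℝ) (U : Matrix (Fin d) (Fin k) ℝ) : Prop :=
  LinearMap.range U.mulVecLin = LinearMap.range Pairs.mulVecLin

/-- Step 2 (whitening): `Vᵀ (Uᵀ Pairs U) V` is the identity matrix. -/
def IsWhitening (Pairs : Matrix (Fin d) (Fin d) ℝ) (U : Matrix (Fin d) (Fin k) ℝ)
    (V : Matrix (Fin k) (Fin k) ℝ) : Prop :=
  Vᵀ * (Uᵀ * Pairs * U) * V = 1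

/-- `A = L diag(s) Rᵀ` is a singular value decomposition of the square matrix `A`. -/
structure IsSVD (A L : Matrix (Fin k) (Fin k) ℝ) (s : Fin k → ℝ)
    (R : Matrix (Fin k) (Fin k) ℝ) : Prop where
  left_orthogonal : L ∈ Matrix.orthogonalGroup (Fin k) ℝ
  right_orthogonal : R ∈ Matrix.orthogonalGroup (Fin k) ℝ
  nonneg : ∀ i, 0 ≤ s i
  eq : A = L * Matrix.diagonal s * Rᵀ

/-- The matrix `Wᵀ Triples(Wθ) W` decomposed in step 3. -/
def whitenedTriples (Triples : (Fin d → ℝ) → Matrix (Fin d) (Fin d) ℝ)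
    (W : Matrix (Fin d) (Fin k) ℝ) (θ : Fin k → ℝ) : Matrix (Fin k) (Fin k) ℝ :=
  Wᵀ * Triples (W *ᵥ θ) * W

/-- The set of left singular vectors (columns of `L`) with unique singular values. -/
def uniqueSingularVectors (L : Matrix (Fin k) (Fin k) ℝ) (s : Fin k → ℝ) : Set (Fin k → ℝ) :=
  {l | ∃ i, l = L.col i ∧ ∀ j, s j = s i → j = i}

/-- Step 4 (reconstruct and normalize): the set of the vectors `(W⁺)ᵀ l / (𝟏ᵀ (W⁺)ᵀ l)`, where `l`
ranges over the left singular vectors with unique singular values. -/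
def output (W : Matrix (Fin d) (Fin k) ℝ) (L : Matrix (Fin k) (Fin k) ℝ) (s : Fin k → ℝ) :
    Set (Fin d → ℝ) :=
  (fun l => ((1 : Fin d → ℝ) ⬝ᵥ ((pinv W)ᵀ *ᵥ l))⁻¹ • ((pinv W)ᵀ *ᵥ l)) ''
    uniqueSingularVectors L s

end Algorithm

/-- The uniform probability measure on the unit sphere of `ℝ^k`. -/
def uniformSphere (k : ℕ) : Measure (Metric.sphere (0 : EuclideanSpace ℝ (Fin k)) 1) :=
  ((volume : Measure (EuclideanSpace ℝ (Fin k))).toSphere Set.univ)⁻¹ •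
    (volume : Measure (EuclideanSpace ℝ (Fin k))).toSphere

end LDA

end

/-! The corrections in the modified moments are chosen so that the latent matrices become diagonal.
Multiplying a Dirichlet density by a coordinate raises one parameter by one
(`lintegral_ofReal_mul_dirichlet`), so all moments up to order three are explicit, and the
off-diagonal terms cancel: `Pairs` and `Triples η` both have the form `O * diagonal _ * Oᵀ`
(`IsModel.pairs_eq`, `IsModel.triples_eq`).

Absorbing square roots of the weights into the columns of `O` gives `A` with `Pairs = A * Aᵀ` and
`Triples η = A * diagonal (κ i * (Aᵀ *ᵥ η) i) * Aᵀ`. Whitening says exactly that `B = Aᵀ * W` is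
orthogonal, so the matrix of step 3 is `Bᵀ * diagonal (κ i * (B *ᵥ θ) i) * B`, and the columns of
`Bᵀ` are an orthonormal eigenbasis. A left singular vector with a simple singular value must be
proportional to one of them (`IsSVD.exists_col_eq_smul`). Since `(pinv W)ᵀ * Bᵀ = A`, step 4 returns
a multiple of a column of `O`, and normalization removes the multiple because that column sums to
one.

All topics appear once the squared eigenvalues are distinct, which fails only for `θ` in finitely
many hyperplanes, a null set on the sphere. The parameters are read off from `pinv O * O = 1`. -/

namespace LDA

open scoped ENNReal

/-! ### Dirichlet's integral by way of the Gamma function. -/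

section DirichletIntegral

/-- **Tonelli's theorem** for a product of functions of one coordinate each. -/
theorem lintegral_fin_prod_eq_prod {n : ℕ} (f : Fin n → ℝ → ℝ≥0∞) (hf : ∀ i, Measurable (f i)) :
    ∫⁻ x : Fin n → ℝ, ∏ i, f i (x i) = ∏ i, ∫⁻ t, f i t := by
  induction n with
  | zero => simp [volume_pi]
  | succ n ih =>
    have hmp := (volume_preserving_piFinSuccAbove (fun _ : Fin (n + 1) => ℝ) 0).symm
    rw [← hmp.lintegral_comp_emb (MeasurableEquiv.measurableEmbedding _)]
    simp only [MeasurableEquiv.piFinSuccAbove_symm_apply, Fin.insertNthEquiv, Fin.prod_univ_succ,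
      Equiv.coe_fn_mk, Fin.insertNth_zero, Fin.cons_zero, Fin.cons_succ]
    rw [← ih (fun i => f i.succ) (fun i => hf _), Measure.volume_eq_prod]
    refine lintegral_prod_mul (μ := volume) (ν := volume) (f := f 0)
      (g := fun x : Fin n → ℝ => ∏ i, f i.succ (x i))
      (hf 0).aemeasurable ?_
    exact (Finset.measurable_fun_prod _ fun i _ =>
      (hf i.succ).comp (measurable_pi_apply i)).aemeasurable

/-- The function `x ↦ x ^ (a - 1)` on the nonnegative reals, extended by zero. -/
noncomputable def powerDensity (a x : ℝ) : ℝ≥0∞ :=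
  if 0 ≤ x then ENNReal.ofReal (x ^ (a - 1)) else 0

theorem measurable_powerDensity (a : ℝ) : Measurable (powerDensity a) :=
  Measurable.ite measurableSet_Ici (by fun_prop) measurable_const

theorem powerDensity_mul {a t : ℝ} (ht : 0 < t) (x : ℝ) :
    powerDensity a (t * x) = ENNReal.ofReal (t ^ (a - 1)) * powerDensity a x := by
  unfold powerDensity
  by_cases hx : 0 ≤ x
  · rw [if_pos (by positivity), if_pos hx, Real.mul_rpow ht.le hx,
      ENNReal.ofReal_mul (by positivity)]
  · rw [if_neg (by rw [mul_nonneg_iff_of_pos_left ht]; exact hx), if_neg hx, mul_zero]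

theorem lintegral_powerDensity_mul_exp {a : ℝ} (ha : 0 < a) :
    ∫⁻ x, powerDensity a x * ENNReal.ofReal (Real.exp (-x)) =
      ENNReal.ofReal (Real.Gamma a) := by
  rw [Real.Gamma_eq_integral ha,
    ofReal_integral_eq_lintegral_ofReal (Real.GammaIntegral_convergent ha)]
  · rw [setLIntegral_congr Ioi_ae_eq_Ici, ← lintegral_indicator measurableSet_Ici]
    refine lintegral_congr fun x => ?_
    unfold powerDensity
    by_cases hx : 0 ≤ x
    · rw [if_pos hx, Set.indicator_of_mem (Set.mem_Ici.2 hx), mul_comm (Real.exp _),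
        ENNReal.ofReal_mul (by positivity)]
    · rw [if_neg hx, Set.indicator_of_notMem (by simpa using hx), zero_mul]
  · filter_upwards [ae_restrict_mem measurableSet_Ioi] with x hx
    have : 0 < x := hx
    positivity

theorem lintegral_comp_smul_eq {m : ℕ} {t : ℝ} (ht : 0 < t) {f : (Fin m → ℝ) → ℝ≥0∞}
    (hf : Measurable f) :
    ∫⁻ y, f y = ENNReal.ofReal (t ^ m) * ∫⁻ y, f (t • y) := by
  have h := Measure.map_addHaar_smul (volume : Measure (Fin m → ℝ)) ht.ne'
  rw [← lintegral_map hf (measurable_const_smul t), h, lintegral_smul_measure, smul_eq_mul,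
    ← mul_assoc, ← ENNReal.ofReal_mul (by positivity), Module.finrank_fin_fun,
    abs_of_pos (by positivity),
    mul_inv_cancel₀ (by positivity), ENNReal.ofReal_one, one_mul]

theorem measurable_simplexPoint {m : ℕ} : Measurable (simplexPoint (m := m)) := by
  refine measurable_pi_lambda _ fun i => ?_
  refine Fin.cases ?_ (fun j => ?_) i
  · simp only [simplexPoint, Fin.cons_zero]; fun_prop
  · simp only [simplexPoint, Fin.cons_succ]; fun_prop

theorem measurable_prod_powerDensity_simplexPoint {m : ℕ} (α : Fin (m + 1) → ℝ) :
    Measurable fun y : Fin m → ℝ => ∏ i, powerDensity (α i) (simplexPoint y i) :=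
  Finset.measurable_fun_prod _ fun i _ =>
    (measurable_powerDensity _).comp ((measurable_pi_apply i).comp measurable_simplexPoint)

/-- **Dirichlet's integral** over the simplex. -/
theorem Gamma_mul_lintegral_simplexPoint {m : ℕ} {α : Fin (m + 1) → ℝ} (hα : ∀ i, 0 < α i) :
    ENNReal.ofReal (Real.Gamma (∑ i, α i)) *
        ∫⁻ y : Fin m → ℝ, ∏ i, powerDensity (α i) (simplexPoint y i) =
      ∏ i, ENNReal.ofReal (Real.Gamma (α i)) := by
  set J := ∫⁻ y : Fin m → ℝ, ∏ i, powerDensity (α i) (simplexPoint y i)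
  set q : (Fin m → ℝ) → ℝ≥0∞ := fun y => ∏ i, powerDensity (α i.succ) (y i) with hq
  have hqm : Measurable q := Finset.measurable_fun_prod _ fun i _ =>
    (measurable_powerDensity _).comp (measurable_pi_apply i)
  have hsum : 0 < ∑ i, α i := Finset.sum_pos (fun i _ => hα i) Finset.univ_nonempty
  have hgq : ∀ t : ℝ, Measurable fun y : Fin m → ℝ =>
      powerDensity (α 0) (t - ∑ i, y i) * q y := fun t =>
    Measurable.mul ((measurable_powerDensity _).comp (by fun_prop)) hqm
  have hexp : Measurable fun t : ℝ => ENNReal.ofReal (Real.exp (-t)) := by fun_prop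
  have hge : ∀ a, Measurable fun t : ℝ => powerDensity a t * ENNReal.ofReal (Real.exp (-t)) :=
    fun a => (measurable_powerDensity a).mul hexp
  -- For `t > 0` the substitution `y ↦ t • y` carries the slice to the unit simplex and produces the
  -- exponent `m + ∑ (α i - 1) = ∑ α i - 1`. For `t < 0` both sides vanish. The null set `t = 0` is
  -- excluded, where `0 ^ 0 = 1` could spoil the identity.
  have inner : ∀ t : ℝ, t ≠ 0 →
      ∫⁻ y, powerDensity (α 0) (t - ∑ i, y i) * q y = powerDensity (∑ i, α i) t * J := by
    intro t ht
    rcases lt_or_gt_of_ne ht with ht | ht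
    · rw [powerDensity, if_neg ht.not_ge, zero_mul]
      refine (lintegral_congr fun y => ?_).trans lintegral_zero
      by_cases hy : ∀ i, 0 ≤ y i
      · have := Finset.sum_nonneg fun i (_ : i ∈ Finset.univ) => hy i
        rw [powerDensity, if_neg (by linarith), zero_mul]
      · push Not at hy
        obtain ⟨i, hi⟩ := hy
        rw [hq]
        simp only
        rw [Finset.prod_eq_zero (Finset.mem_univ i), mul_zero]
        rw [powerDensity, if_neg hi.not_ge]
    · rw [lintegral_comp_smul_eq ht (hgq t)]
      have : ∀ y : Fin m → ℝ,
          powerDensity (α 0) (t - ∑ i, (t • y) i) * q (t • y) =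
            (∏ i, ENNReal.ofReal (t ^ (α i - 1))) * ∏ i, powerDensity (α i) (simplexPoint y i) := by
        intro y
        simp only [hq, Pi.smul_apply, smul_eq_mul, ← Finset.mul_sum, powerDensity_mul ht,
          Fin.prod_univ_succ, simplexPoint, Fin.cons_zero, Fin.cons_succ, Finset.prod_mul_distrib]
        rw [show t - t * ∑ i, y i = t * (1 - ∑ i, y i) by ring, powerDensity_mul ht]
        ring
      rw [lintegral_congr this, lintegral_const_mul _ (measurable_prod_powerDensity_simplexPoint α),
        ← mul_assoc]
      congr 1
      rw [powerDensity, if_pos ht.le, ← ENNReal.ofReal_prod_of_nonneg (fun i _ => by positivity),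
        ← ENNReal.ofReal_mul (by positivity), ← Real.rpow_sum_of_pos ht, ← Real.rpow_natCast,
        ← Real.rpow_add ht]
      congr 2
      simp
      ring
  -- One double integral in two orders: with `t` outside it is the left side by `inner`; with `y`
  -- outside, shifting `t` by `∑ i, y i` splits it into one-dimensional Gamma integrals.
  calc ENNReal.ofReal (Real.Gamma (∑ i, α i)) * J
      = ∫⁻ t, powerDensity (∑ i, α i) t * ENNReal.ofReal (Real.exp (-t)) * J := by
        rw [lintegral_mul_const _ (hge _),
          lintegral_powerDensity_mul_exp hsum]
    _ = ∫⁻ t, ∫⁻ y, powerDensity (α 0) (t - ∑ i, y i) * q y * ENNReal.ofReal (Real.exp (-t)) := by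
        refine lintegral_congr_ae ?_
        filter_upwards [Measure.ae_ne volume (0 : ℝ)] with t ht
        rw [lintegral_mul_const _ (hgq t), inner t ht]
        ring
    _ = ∫⁻ y, ∫⁻ t, powerDensity (α 0) (t - ∑ i, y i) * q y * ENNReal.ofReal (Real.exp (-t)) := by
        refine lintegral_lintegral_swap (Measurable.aemeasurable ?_)
        refine ((((measurable_powerDensity _).comp ?_)).mul (hqm.comp measurable_snd)).mul
          (hexp.comp measurable_fst)
        fun_prop
    _ = ∫⁻ y : Fin m → ℝ, ∫⁻ s, powerDensity (α 0) s * ENNReal.ofReal (Real.exp (-s)) *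
          ∏ i, (powerDensity (α i.succ) (y i) * ENNReal.ofReal (Real.exp (-(y i)))) := by
        refine lintegral_congr fun y => ?_
        rw [← lintegral_add_right_eq_self _ (∑ i, y i)]
        refine lintegral_congr fun s => ?_
        rw [add_sub_cancel_right, neg_add, Real.exp_add, ENNReal.ofReal_mul (by positivity),
          ← Finset.sum_neg_distrib, Real.exp_sum,
          ENNReal.ofReal_prod_of_nonneg (fun i _ => by positivity), Finset.prod_mul_distrib]
        ring
    _ = ∏ i, ENNReal.ofReal (Real.Gamma (α i)) := by
        simp_rw [lintegral_mul_const _ (hge (α 0)),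
          lintegral_powerDensity_mul_exp (hα 0)]
        rw [lintegral_const_mul, lintegral_fin_prod_eq_prod (fun i x =>
          powerDensity (α i.succ) x * ENNReal.ofReal (Real.exp (-x)))
          (fun i => hge _), Fin.prod_univ_succ]
        · simp_rw [lintegral_powerDensity_mul_exp (hα _)]
        · exact Finset.measurable_fun_prod _ fun i _ => (hge _).comp
            (measurable_pi_apply i)

end DirichletIntegral

end LDA

namespace LDA

open scoped ENNReal

/-! ### Moments of the Dirichlet distribution. -/

section DirichletMoments

theorem simplexPoint_mem_stdSimplex_iff {m : ℕ} (y : Fin m → ℝ) :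
    simplexPoint y ∈ stdSimplex ℝ (Fin (m + 1)) ↔ ∀ i, 0 ≤ simplexPoint y i := by
  refine ⟨fun h => h.1, fun h => ⟨h, ?_⟩⟩
  simp [Fin.sum_univ_succ, simplexPoint]

theorem measurableSet_simplexPoint_mem {m : ℕ} :
    MeasurableSet {y : Fin m → ℝ | simplexPoint y ∈ stdSimplex ℝ (Fin (m + 1))} :=
  measurable_simplexPoint (isClosed_stdSimplex ℝ (Fin (m + 1))).measurableSet

theorem dirichletZ_pos {k : ℕ} {α : Fin k → ℝ} (hα : ∀ i, 0 < α i) (hk : 0 < k) :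
    0 < dirichletZ α := by
  have : Nonempty (Fin k) := ⟨⟨0, hk⟩⟩
  exact div_pos (Finset.prod_pos fun i _ => Real.Gamma_pos_of_pos (hα i))
    (Real.Gamma_pos_of_pos (Finset.sum_pos (fun i _ => hα i) Finset.univ_nonempty))

/-- Since `powerDensity` vanishes on negative numbers, the product already encodes the restriction
to the simplex, and the integral can run over the whole space. -/
theorem lintegral_dirichlet {m : ℕ} {α : Fin (m + 1) → ℝ} (hα : ∀ i, 0 < α i)
    {f : (Fin (m + 1) → ℝ) → ℝ≥0∞} (hf : Measurable f) :
    ∫⁻ p, f p ∂(dirichlet α) = ENNReal.ofReal (dirichletZ α)⁻¹ *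
      ∫⁻ y, f (simplexPoint y) * ∏ i, powerDensity (α i) (simplexPoint y i) := by
  have hZ := dirichletZ_pos hα m.succ_pos
  have hd : Measurable fun y : Fin m → ℝ =>
      ENNReal.ofReal ((dirichletZ α)⁻¹ * ∏ i, simplexPoint y i ^ (α i - 1)) := by
    refine ENNReal.measurable_ofReal.comp (measurable_const.mul ?_)
    exact Finset.measurable_fun_prod _ fun i _ =>
      ((measurable_pi_apply i).comp measurable_simplexPoint).pow_const _
  have hfs := hf.comp (measurable_simplexPoint (m := m))
  rw [dirichlet, lintegral_map hf measurable_simplexPoint]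
  have e := lintegral_withDensity_eq_lintegral_mul
    (volume.restrict {y : Fin m → ℝ | simplexPoint y ∈ stdSimplex ℝ (Fin (m + 1))}) hd hfs
  simp only [Function.comp_apply] at e
  rw [e, ← lintegral_indicator measurableSet_simplexPoint_mem,
    ← lintegral_const_mul _ (by exact hfs.mul (measurable_prod_powerDensity_simplexPoint α))]
  refine lintegral_congr fun y => ?_
  by_cases hy : simplexPoint y ∈ stdSimplex ℝ (Fin (m + 1))
  · rw [Set.indicator_of_mem (by exact hy)]
    rw [simplexPoint_mem_stdSimplex_iff] at hy
    simp only [Pi.mul_apply, Function.comp_apply, powerDensity, hy, if_true]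
    rw [ENNReal.ofReal_mul (by positivity),
      ENNReal.ofReal_prod_of_nonneg (fun i _ => Real.rpow_nonneg (hy i) _)]
    ring
  · rw [Set.indicator_of_notMem (by exact hy)]
    rw [simplexPoint_mem_stdSimplex_iff] at hy
    push Not at hy
    obtain ⟨i, hi⟩ := hy
    rw [Finset.prod_eq_zero (Finset.mem_univ i), mul_zero, mul_zero]
    rw [powerDensity, if_neg hi.not_ge]

theorem dirichlet_univ {k : ℕ} {α : Fin k → ℝ} (hα : ∀ i, 0 < α i) (hk : 0 < k) :
    dirichlet α Set.univ = 1 := by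
  obtain ⟨m, rfl⟩ : ∃ m, k = m + 1 := ⟨k - 1, by omega⟩
  have hsum : 0 < ∑ i, α i := Finset.sum_pos (fun i _ => hα i) Finset.univ_nonempty
  have hΓ := Real.Gamma_pos_of_pos hsum
  have hP : 0 < ∏ i, Real.Gamma (α i) := Finset.prod_pos fun i _ => Real.Gamma_pos_of_pos (hα i)
  have h := lintegral_dirichlet hα (f := fun _ => 1) measurable_const
  have hD := Gamma_mul_lintegral_simplexPoint hα
  simp only [lintegral_one, one_mul] at h
  rw [h, dirichletZ, inv_div, div_eq_inv_mul, ENNReal.ofReal_mul (by positivity), mul_assoc, hD,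
    ← ENNReal.ofReal_prod_of_nonneg (fun i _ => (Real.Gamma_pos_of_pos (hα i)).le),
    ← ENNReal.ofReal_mul (by positivity), inv_mul_cancel₀ hP.ne', ENNReal.ofReal_one]

/-- Positivity of `a` matters at `x = 0`, where the right side is `0 ^ a`. -/
theorem ofReal_mul_powerDensity {a : ℝ} (ha : 0 < a) (x : ℝ) :
    ENNReal.ofReal x * powerDensity a x = powerDensity (a + 1) x := by
  unfold powerDensity
  split_ifs with hx
  · rw [← ENNReal.ofReal_mul hx, add_sub_cancel_right]
    rcases hx.eq_or_lt with rfl | hx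
    · rw [zero_mul, Real.zero_rpow ha.ne']
    · rw [Real.rpow_sub_one hx.ne', mul_div_cancel₀ _ hx.ne']
  · simp

/-- The parameter vector `α` with its `i`-th entry increased by one. -/
def incr {k : ℕ} (α : Fin k → ℝ) (i : Fin k) : Fin k → ℝ := α + Pi.single i 1

theorem incr_apply {k : ℕ} (α : Fin k → ℝ) (i j : Fin k) :
    incr α i j = α j + if j = i then 1 else 0 := by
  rw [incr, Pi.add_apply, Pi.single_apply]

theorem incr_pos {k : ℕ} {α : Fin k → ℝ} (hα : ∀ i, 0 < α i) (i j : Fin k) :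
    0 < incr α i j := by
  rw [incr_apply]
  split_ifs <;> linarith [hα j]

theorem sum_incr {k : ℕ} (α : Fin k → ℝ) (i : Fin k) :
    ∑ j, incr α i j = ∑ j, α j + 1 := by
  simp [incr_apply, Finset.sum_add_distrib]

/-- The functional equation of `Γ`, used once in the `i`-th factor and once for the total. -/
theorem dirichletZ_incr {k : ℕ} {α : Fin k → ℝ} (hα : ∀ i, 0 < α i) (i : Fin k) :
    dirichletZ (incr α i) = α i / (∑ j, α j) * dirichletZ α := by
  have hsum : 0 < ∑ i, α i := Finset.sum_pos (fun i _ => hα i) ⟨i, Finset.mem_univ i⟩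
  rw [dirichletZ, dirichletZ, sum_incr, Real.Gamma_add_one hsum.ne',
    ← Finset.mul_prod_erase Finset.univ (fun j => Real.Gamma (incr α i j))
      (Finset.mem_univ i),
    ← Finset.mul_prod_erase Finset.univ (fun j => Real.Gamma (α j)) (Finset.mem_univ i)]
  have h : ∀ j ∈ Finset.univ.erase i,
      Real.Gamma (incr α i j) = Real.Gamma (α j) := fun j hj => by
    simp [incr_apply, Finset.ne_of_mem_erase hj]
  rw [Finset.prod_congr rfl h]
  simp only [incr_apply, if_true]
  rw [Real.Gamma_add_one (hα i).ne', div_mul_div_comm, mul_assoc]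

/-- Weighting a Dirichlet distribution by a coordinate increments the corresponding parameter. -/
theorem lintegral_ofReal_mul_dirichlet {k : ℕ} {α : Fin k → ℝ} (hα : ∀ i, 0 < α i) (i : Fin k)
    {f : (Fin k → ℝ) → ℝ≥0∞} (hf : Measurable f) :
    ∫⁻ p, ENNReal.ofReal (p i) * f p ∂(dirichlet α) =
      ENNReal.ofReal (α i / ∑ j, α j) * ∫⁻ p, f p ∂(dirichlet (incr α i)) := by
  obtain ⟨m, rfl⟩ : ∃ m, k = m + 1 := ⟨k - 1, by have := i.2; omega⟩
  have hsum : 0 < ∑ i, α i := Finset.sum_pos (fun i _ => hα i) Finset.univ_nonempty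
  have hi := hα i
  have hZ := dirichletZ_pos hα m.succ_pos
  rw [lintegral_dirichlet hα (by fun_prop), lintegral_dirichlet (incr_pos hα i) hf,
    ← mul_assoc, ← ENNReal.ofReal_mul (by positivity), dirichletZ_incr hα]
  congr 1
  · congr 1
    field_simp
  · refine lintegral_congr fun y => ?_
    rw [← Finset.mul_prod_erase Finset.univ
        (fun j => powerDensity (incr α i j) (simplexPoint y j)) (Finset.mem_univ i),
      ← Finset.mul_prod_erase Finset.univ
        (fun j => powerDensity (α j) (simplexPoint y j)) (Finset.mem_univ i)]
    have h : ∀ j ∈ Finset.univ.erase i, powerDensity (incr α i j) (simplexPoint y j) =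
        powerDensity (α j) (simplexPoint y j) := fun j hj => by
      simp [incr_apply, Finset.ne_of_mem_erase hj]
    rw [Finset.prod_congr rfl h]
    simp only [incr_apply, if_true]
    rw [← ofReal_mul_powerDensity hi]
    ring

theorem lintegral_coord_dirichlet {k : ℕ} {α : Fin k → ℝ} (hα : ∀ i, 0 < α i) (i : Fin k) :
    ∫⁻ p, ENNReal.ofReal (p i) ∂(dirichlet α) = ENNReal.ofReal (α i / ∑ j, α j) := by
  have h := lintegral_ofReal_mul_dirichlet hα i (f := fun _ => 1) measurable_const
  simpa [dirichlet_univ (incr_pos hα i) (by have := i.2; omega)] using h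

/-- Peel off one coordinate and take the remaining moment at the incremented parameter; the extra
one in `incr α i j` for `j = i` is what survives later on the diagonal. -/
theorem lintegral_coord_mul_coord_dirichlet {k : ℕ} {α : Fin k → ℝ} (hα : ∀ i, 0 < α i)
    (i j : Fin k) :
    ∫⁻ p, ENNReal.ofReal (p i) * ENNReal.ofReal (p j) ∂(dirichlet α) =
      ENNReal.ofReal (α i / (∑ l, α l) * (incr α i j / (∑ l, α l + 1))) := by
  have hsum : 0 < ∑ i, α i := Finset.sum_pos (fun i _ => hα i) ⟨i, Finset.mem_univ i⟩
  have hi := hα i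
  rw [lintegral_ofReal_mul_dirichlet hα i (by fun_prop),
    lintegral_coord_dirichlet (incr_pos hα i), sum_incr,
    ENNReal.ofReal_mul (by positivity)]

theorem lintegral_coord_mul_coord_mul_coord_dirichlet {k : ℕ} {α : Fin k → ℝ}
    (hα : ∀ i, 0 < α i) (i j l : Fin k) :
    ∫⁻ p, ENNReal.ofReal (p i) * (ENNReal.ofReal (p j) * ENNReal.ofReal (p l)) ∂(dirichlet α) =
      ENNReal.ofReal (α i / (∑ l, α l) * (incr α i j / (∑ l, α l + 1) *
        (incr (incr α i) j l / (∑ l, α l + 2)))) := by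
  have hsum : 0 < ∑ i, α i := Finset.sum_pos (fun i _ => hα i) ⟨i, Finset.mem_univ i⟩
  have hi := hα i
  rw [lintegral_ofReal_mul_dirichlet hα i (by fun_prop),
    lintegral_coord_mul_coord_dirichlet (incr_pos hα i), sum_incr,
    ENNReal.ofReal_mul (p := α i / _) (by positivity), add_assoc (∑ l, α l), one_add_one_eq_two]

end DirichletMoments

/-! ### From Dirichlet moments to moments of the observed words. -/

section WordMoments

/-- `E[hᵢ]` for `h` Dirichlet distributed. -/
noncomputable def dirichletMean {k : ℕ} (α : Fin k → ℝ) : Fin k → ℝ := fun i => α i / ∑ l, α l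

/-- `E[hᵢ hⱼ]` for `h` Dirichlet distributed. -/
noncomputable def dirichletSecond {k : ℕ} (α : Fin k → ℝ) : Matrix (Fin k) (Fin k) ℝ :=
  Matrix.of fun i j => α i / (∑ l, α l) * (incr α i j / (∑ l, α l + 1))

/-- `E[hᵢ hⱼ hₗ]` for `h` Dirichlet distributed. -/
noncomputable def dirichletThird {k : ℕ} (α : Fin k → ℝ) (i j l : Fin k) : ℝ :=
  α i / (∑ l, α l) * (incr α i j / (∑ l, α l + 1) *
    (incr (incr α i) j l / (∑ l, α l + 2)))

variable {Ω : Type*} [MeasurableSpace Ω] {P : Measure Ω} {d k : ℕ}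
  {α : Fin k → ℝ} {O : Matrix (Fin d) (Fin k) ℝ}
  {h : Ω → Fin k → ℝ} {z : ℕ → Ω → Fin k} {w : ℕ → Ω → Fin d}

/-- The event `p` need not be measurable: the fibres of `ζ` are, and additivity is applied to `P`
restricted to the event. -/
theorem real_eq_sum_fiber [IsFiniteMeasure P] {ζ : Ω → Fin k} (hζ : Measurable ζ)
    (p : Ω → Prop) : P.real {ω | p ω} = ∑ i, P.real {ω | ζ ω = i ∧ p ω} := by
  have hi : ∀ i, MeasurableSet (ζ ⁻¹' {i}) := fun i => hζ (measurableSet_singleton i)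
  have h := sum_measure_preimage_singleton (μ := P.restrict {ω | p ω}) (f := ζ) Finset.univ
    (fun i _ => hi i)
  simp only [Finset.coe_univ, Set.preimage_univ, Measure.restrict_apply_univ,
    Measure.restrict_apply (hi _)] at h
  rw [measureReal_def, ← h, ENNReal.toReal_sum (fun i _ => measure_ne_top _ _)]
  rfl

/-- Marginalizing `law_words` over the hidden topics leaves one Dirichlet moment per topic
assignment. The cases of two and three words follow the same pattern. -/
theorem IsModel.real_word_eq [IsFiniteMeasure P] (hm : IsModel P α O h z w) (hα : ∀ i, 0 < α i)
    (hO : ∀ a i, 0 ≤ O a i) (a : Fin d) :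
    P.real {ω | w 0 ω = a} = ∑ i, O a i * dirichletMean α i := by
  have hsum : 0 ≤ ∑ i, α i := Finset.sum_nonneg fun i _ => (hα i).le
  rw [real_eq_sum_fiber (hm.measurable_z 0)]
  refine Finset.sum_congr rfl fun i _ => ?_
  have hl := hm.law_words 1 Set.univ .univ ![i] ![a]
  simp only [Set.mem_univ, true_and, Fin.forall_fin_one, Fin.prod_univ_one, Measure.restrict_univ,
    hm.law_h, Fin.val_zero, Matrix.cons_val_zero, ENNReal.ofReal_mul' (hO _ _)] at hl
  rw [lintegral_mul_const _ (by fun_prop), lintegral_coord_dirichlet hα,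
    ← ENNReal.ofReal_mul' (hO a i)] at hl
  have := hα i
  have := hO a i
  rw [measureReal_def, hl, ENNReal.toReal_ofReal (by positivity), dirichletMean, mul_comm]

theorem IsModel.real_word_pair_eq [IsFiniteMeasure P] (hm : IsModel P α O h z w)
    (hα : ∀ i, 0 < α i) (hO : ∀ a i, 0 ≤ O a i) (a b : Fin d) :
    P.real {ω | w 0 ω = a ∧ w 1 ω = b} =
      ∑ i, ∑ j, O a i * O b j * dirichletSecond α i j := by
  have hsum : 0 ≤ ∑ i, α i := Finset.sum_nonneg fun i _ => (hα i).le
  rw [real_eq_sum_fiber (hm.measurable_z 0)]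
  refine Finset.sum_congr rfl fun i _ => ?_
  rw [real_eq_sum_fiber (hm.measurable_z 1)]
  refine Finset.sum_congr rfl fun j _ => ?_
  have hset : {ω | z 1 ω = j ∧ z 0 ω = i ∧ w 0 ω = a ∧ w 1 ω = b} =
      {ω | (z 0 ω = i ∧ w 0 ω = a) ∧ z 1 ω = j ∧ w 1 ω = b} := by
    ext ω; simp only [Set.mem_ofPred_eq]; tauto
  have hl := hm.law_words 2 Set.univ .univ ![i, j] ![a, b]
  have e : ∀ p : Fin k → ℝ, ∏ v : Fin 2,
      ENNReal.ofReal (p (![i, j] v) * O (![a, b] v) (![i, j] v)) =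
        ENNReal.ofReal (p i) * ENNReal.ofReal (p j) * ENNReal.ofReal (O a i * O b j) := fun p => by
    rw [Fin.prod_univ_two, ENNReal.ofReal_mul (hO a i)]
    simp only [ENNReal.ofReal_mul' (hO _ _), Matrix.cons_val_zero, Matrix.cons_val_one]
    ring
  simp only [Set.mem_univ, true_and, Fin.forall_fin_two, Measure.restrict_univ, e,
    hm.law_h, Fin.val_zero, Fin.val_one, Matrix.cons_val_zero, Matrix.cons_val_one] at hl
  rw [lintegral_mul_const _ (by fun_prop), lintegral_coord_mul_coord_dirichlet hα,
    ← ENNReal.ofReal_mul' (mul_nonneg (hO a i) (hO b j))] at hl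
  have := hα i
  have := hO a i
  have := hO b j
  have := incr_pos hα i j
  rw [hset, measureReal_def, hl, ENNReal.toReal_ofReal (by positivity), dirichletSecond,
    Matrix.of_apply, mul_comm]

theorem IsModel.real_word_triple_eq [IsFiniteMeasure P] (hm : IsModel P α O h z w)
    (hα : ∀ i, 0 < α i) (hO : ∀ a i, 0 ≤ O a i) (a b c : Fin d) :
    P.real {ω | w 0 ω = a ∧ w 1 ω = b ∧ w 2 ω = c} =
      ∑ i, ∑ j, ∑ l, O a i * (O b j * O c l) * dirichletThird α i j l := by
  have hsum : 0 ≤ ∑ i, α i := Finset.sum_nonneg fun i _ => (hα i).le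
  rw [real_eq_sum_fiber (hm.measurable_z 0)]
  refine Finset.sum_congr rfl fun i _ => ?_
  rw [real_eq_sum_fiber (hm.measurable_z 1)]
  refine Finset.sum_congr rfl fun j _ => ?_
  rw [real_eq_sum_fiber (hm.measurable_z 2)]
  refine Finset.sum_congr rfl fun l _ => ?_
  have hset : {ω | z 2 ω = l ∧ z 1 ω = j ∧ z 0 ω = i ∧ w 0 ω = a ∧ w 1 ω = b ∧ w 2 ω = c} =
      {ω | (z 0 ω = i ∧ w 0 ω = a) ∧ (z 1 ω = j ∧ w 1 ω = b) ∧ z 2 ω = l ∧ w 2 ω = c} := by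
    ext ω; simp only [Set.mem_ofPred_eq]; tauto
  have hl := hm.law_words 3 Set.univ .univ ![i, j, l] ![a, b, c]
  have e : ∀ p : Fin k → ℝ, ∏ v : Fin 3,
      ENNReal.ofReal (p (![i, j, l] v) * O (![a, b, c] v) (![i, j, l] v)) =
        ENNReal.ofReal (p i) * (ENNReal.ofReal (p j) * ENNReal.ofReal (p l)) *
          ENNReal.ofReal (O a i * (O b j * O c l)) := fun p => by
    rw [Fin.prod_univ_three, ENNReal.ofReal_mul (hO a i), ENNReal.ofReal_mul (hO b j)]
    simp only [ENNReal.ofReal_mul' (hO _ _), Matrix.cons_val_zero, Matrix.cons_val_one,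
      Matrix.cons_val]
    ring
  have e' : ∀ ω, (∀ v : Fin 3, z v ω = ![i, j, l] v ∧ w v ω = ![a, b, c] v) ↔
      ((z 0 ω = i ∧ w 0 ω = a) ∧ (z 1 ω = j ∧ w 1 ω = b) ∧ z 2 ω = l ∧ w 2 ω = c) := fun ω => by
    simp [Fin.forall_fin_succ]
  simp only [Set.mem_univ, true_and, Measure.restrict_univ, hm.law_h, e, e'] at hl
  have hn := mul_nonneg (hO a i) (mul_nonneg (hO b j) (hO c l))
  rw [lintegral_mul_const _ (by fun_prop), lintegral_coord_mul_coord_mul_coord_dirichlet hα,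
    ← ENNReal.ofReal_mul' hn] at hl
  have := hα i
  have := incr_pos hα i j
  have := incr_pos (incr_pos hα i) j l
  rw [hset, measureReal_def, hl, ENNReal.toReal_ofReal (by positivity), dirichletThird, mul_comm]

/-- Products of one-hot coordinates are indicators of word events, so the expectations are the
probabilities computed above; likewise for the next two moments. -/
theorem IsModel.mean_eq [IsFiniteMeasure P] (hm : IsModel P α O h z w) (hα : ∀ i, 0 < α i)
    (hO : ∀ a i, 0 ≤ O a i) : mean P (oneHot w) = O *ᵥ dirichletMean α := by
  ext a
  have hs : MeasurableSet {ω | w 0 ω = a} := hm.measurable_w 0 (measurableSet_singleton a)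
  have e : ∀ ω, oneHot w 0 ω a = {ω | w 0 ω = a}.indicator 1 ω := fun ω => by
    simp [oneHot, Pi.single_apply, Set.indicator_apply, eq_comm]
  simp_rw [mean, e]
  rw [integral_indicator_one hs, hm.real_word_eq hα hO]
  rfl

theorem IsModel.secondMoment_eq [IsFiniteMeasure P] (hm : IsModel P α O h z w)
    (hα : ∀ i, 0 < α i) (hO : ∀ a i, 0 ≤ O a i) :
    secondMoment P (oneHot w) = O * dirichletSecond α * Oᵀ := by
  ext a b
  have hs : MeasurableSet {ω | w 0 ω = a ∧ w 1 ω = b} :=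
    (hm.measurable_w 0 (measurableSet_singleton a)).inter
      (hm.measurable_w 1 (measurableSet_singleton b))
  have e : ∀ ω, oneHot w 0 ω a * oneHot w 1 ω b =
      {ω | w 0 ω = a ∧ w 1 ω = b}.indicator 1 ω := fun ω => by
    simp only [oneHot, Pi.single_apply, Set.indicator_apply, Set.mem_ofPred_eq, Pi.one_apply,
      mul_ite, mul_one, mul_zero, ite_and, eq_comm (a := a), eq_comm (a := b)]
    split_ifs <;> rfl
  simp_rw [secondMoment, Matrix.of_apply, e]
  rw [integral_indicator_one hs, hm.real_word_pair_eq hα hO, Finset.sum_comm]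
  simp only [Matrix.mul_apply, Matrix.transpose_apply, Finset.sum_mul]
  exact Finset.sum_congr rfl fun j _ => Finset.sum_congr rfl fun i _ => by ring

theorem IsModel.thirdMoment_eq [IsFiniteMeasure P] (hm : IsModel P α O h z w)
    (hα : ∀ i, 0 < α i) (hO : ∀ a i, 0 ≤ O a i) (η : Fin d → ℝ) :
    thirdMoment P (oneHot w) η =
      O * (Matrix.of fun i j => ∑ l, dirichletThird α i j l * (Oᵀ *ᵥ η) l) * Oᵀ := by
  ext a b
  have hs : ∀ c, MeasurableSet {ω | w 0 ω = a ∧ w 1 ω = b ∧ w 2 ω = c} := fun c =>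
    (hm.measurable_w 0 (measurableSet_singleton a)).inter
      ((hm.measurable_w 1 (measurableSet_singleton b)).inter
        (hm.measurable_w 2 (measurableSet_singleton c)))
  have e : ∀ ω, oneHot w 0 ω a * oneHot w 1 ω b * (η ⬝ᵥ oneHot w 2 ω) =
      ∑ c, η c * {ω | w 0 ω = a ∧ w 1 ω = b ∧ w 2 ω = c}.indicator 1 ω := fun ω => by
    rw [dotProduct, Finset.mul_sum]
    refine Finset.sum_congr rfl fun c _ => ?_
    simp only [oneHot, Pi.single_apply, Set.indicator_apply, Set.mem_ofPred_eq, Pi.one_apply,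
      mul_ite, mul_one, mul_zero, ite_and, eq_comm (a := a), eq_comm (a := b), eq_comm (a := c)]
    split_ifs <;> simp
  simp_rw [thirdMoment, Matrix.of_apply, e]
  rw [integral_finsetSum _ fun c _ =>
    ((integrable_indicator_iff (hs c)).2 (integrable_const 1).integrableOn).const_mul _]
  simp_rw [integral_const_mul, integral_indicator_one (hs _), hm.real_word_triple_eq hα hO]
  simp only [Matrix.mul_apply, Matrix.transpose_apply, Matrix.of_apply, mulVec, dotProduct,
    Finset.sum_mul, Finset.mul_sum]
  rw [Finset.sum_comm]
  conv_rhs => rw [Finset.sum_comm]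
  refine Finset.sum_congr rfl fun i _ => ?_
  rw [Finset.sum_comm]
  refine Finset.sum_congr rfl fun j _ => ?_
  rw [Finset.sum_comm]
  exact Finset.sum_congr rfl fun l _ => Finset.sum_congr rfl fun c _ => by ring

end WordMoments
end LDA

namespace LDA

/-! ### Diagonal form of the modified moments. -/

section ModifiedMoments

variable {k : ℕ} {α : Fin k → ℝ}

theorem dirichletSecond_mulVec (β : Fin k → ℝ) (i : Fin k) :
    (dirichletSecond α *ᵥ β) i =
      α i / (∑ l, α l) * ((∑ l, α l * β l + β i) / (∑ l, α l + 1)) := by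
  have : ∀ j, dirichletSecond α i j * β j = α i / (∑ l, α l) *
      ((α j * β j + if j = i then β j else 0) / (∑ l, α l + 1)) := fun j => by
    rw [dirichletSecond, Matrix.of_apply, incr_apply]
    split_ifs <;> ring
  simp only [mulVec, dotProduct, this, ← Finset.mul_sum, ← Finset.sum_div,
    Finset.sum_add_distrib, Finset.sum_ite_eq', Finset.mem_univ, if_true]

theorem dirichletSecond_isSymm : (dirichletSecond α)ᵀ = dirichletSecond α := by
  ext i j
  simp only [Matrix.transpose_apply, dirichletSecond, Matrix.of_apply, incr_apply]
  by_cases h : i = j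
  · subst h; rfl
  · rw [if_neg h, if_neg (Ne.symm h)]; ring

theorem sum_dirichletThird_mul (β : Fin k → ℝ) (i j : Fin k) :
    ∑ l, dirichletThird α i j l * β l = α i / (∑ l, α l) * (incr α i j / (∑ l, α l + 1) *
      ((∑ l, α l * β l + β i + β j) / (∑ l, α l + 2))) := by
  have : ∀ l, dirichletThird α i j l * β l = α i / (∑ l, α l) * (incr α i j / (∑ l, α l + 1) *
      (((α l * β l + if l = i then β l else 0) + if l = j then β l else 0)
        / (∑ l, α l + 2))) := fun l => by
    rw [dirichletThird, incr_apply (incr α i), incr_apply α i l]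
    split_ifs <;> ring
  simp only [this, ← Finset.mul_sum, ← Finset.sum_div,
    Finset.sum_add_distrib, Finset.sum_ite_eq', Finset.mem_univ, if_true]

variable {Ω : Type*} [MeasurableSpace Ω] {P : Measure Ω} {d : ℕ}
  {O : Matrix (Fin d) (Fin k) ℝ}
  {h : Ω → Fin k → ℝ} {z : ℕ → Ω → Fin k} {w : ℕ → Ω → Fin d}

/-- For `i ≠ j`, `E[hᵢ hⱼ]` is exactly `α₀ / (α₀ + 1)` times the product of the means; for `i = j`
it exceeds this by `αᵢ / (α₀ (α₀ + 1))`. -/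
theorem IsModel.pairs_eq [IsFiniteMeasure P] (hm : IsModel P α O h z w)
    (hα : ∀ i, 0 < α i) (hO : ∀ a i, 0 ≤ O a i) :
    pairs P (oneHot w) (∑ i, α i) =
      O * diagonal (fun i => α i / ((∑ l, α l) * (∑ l, α l + 1))) * Oᵀ := by
  have hD : diagonal (fun i => α i / ((∑ l, α l) * (∑ l, α l + 1))) = dirichletSecond α -
      ((∑ i, α i) / (∑ i, α i + 1)) • vecMulVec (dirichletMean α) (dirichletMean α) := by
    ext i j
    have hsum : 0 < ∑ i, α i := Finset.sum_pos (fun i _ => hα i) ⟨i, Finset.mem_univ i⟩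
    simp only [diagonal_apply, Matrix.sub_apply, Matrix.smul_apply, vecMulVec_apply, smul_eq_mul,
      dirichletSecond, dirichletMean, Matrix.of_apply, incr_apply]
    by_cases hij : i = j
    · subst hij
      simp only [if_true]
      field_simp
      ring
    · rw [if_neg hij, if_neg (Ne.symm hij)]
      field_simp
      ring
  rw [hD, pairs, hm.secondMoment_eq hα hO, hm.mean_eq hα hO, Matrix.mul_sub, Matrix.sub_mul,
    Matrix.mul_smul, Matrix.smul_mul, mul_vecMulVec, vecMulVec_mul, vecMul_transpose]

/-- Contracting with `β = Oᵀ *ᵥ η` reduces the claim to `k × k` matrices. Over the common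
denominator `a (a + 1) (a + 2)`, the parts of the form `αᵢ αⱼ (⟨α, β⟩ + βᵢ + βⱼ)` cancel. The
diagonal excess `αᵢ (⟨α, β⟩ + 2 βᵢ)` loses its first term to `(β ⬝ᵥ u) • S`, leaving `2 αᵢ βᵢ`. -/
theorem IsModel.triples_eq [IsFiniteMeasure P] (hm : IsModel P α O h z w)
    (hα : ∀ i, 0 < α i) (hO : ∀ a i, 0 ≤ O a i) (η : Fin d → ℝ) :
    triples P (oneHot w) (∑ i, α i) η =
      O * diagonal (fun i => 2 * α i * (Oᵀ *ᵥ η) i /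
        ((∑ l, α l) * (∑ l, α l + 1) * (∑ l, α l + 2))) * Oᵀ := by
  set β := Oᵀ *ᵥ η with hβ
  set S := dirichletSecond α with hS
  set u := dirichletMean α with hu
  set a := ∑ l, α l with ha
  have hD : diagonal (fun i => 2 * α i * β i / (a * (a + 1) * (a + 2))) =
      (Matrix.of fun i j => ∑ l, dirichletThird α i j l * β l)
        - (a / (a + 2)) • (vecMulVec (S *ᵥ β) u + vecMulVec u (S *ᵥ β) + (β ⬝ᵥ u) • S)
        + (2 * a ^ 2 / ((a + 2) * (a + 1))) • ((β ⬝ᵥ u) • vecMulVec u u) := by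
    ext i j
    have hsum : 0 < a := Finset.sum_pos (fun i _ => hα i) ⟨i, Finset.mem_univ i⟩
    have hβu : β ⬝ᵥ u = (∑ l, α l * β l) / a := by
      rw [dotProduct, Finset.sum_div]
      exact Finset.sum_congr rfl fun l _ => by rw [hu, dirichletMean]; ring
    simp only [diagonal_apply, Matrix.sub_apply, Matrix.add_apply, Matrix.smul_apply,
      vecMulVec_apply, smul_eq_mul, hS, dirichletSecond_mulVec, Matrix.of_apply,
      sum_dirichletThird_mul, hβu]
    simp only [dirichletSecond, hu, dirichletMean, Matrix.of_apply, incr_apply, ← ha]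
    by_cases hij : i = j
    · subst hij
      simp only [if_true]
      field_simp
      ring
    · rw [if_neg hij, if_neg (Ne.symm hij)]
      field_simp
      ring
  have hηu : η ⬝ᵥ O *ᵥ u = β ⬝ᵥ u := by rw [dotProduct_mulVec, hβ, mulVec_transpose]
  have h1 : O * S * Oᵀ * vecMulVec η (O *ᵥ u) = O * vecMulVec (S *ᵥ β) u * Oᵀ := by
    rw [mul_vecMulVec, mul_vecMulVec, vecMulVec_mul, vecMul_transpose, hβ, mulVec_mulVec,
      mulVec_mulVec, Matrix.mul_assoc]
  have h2 : vecMulVec (O *ᵥ u) η * (O * S * Oᵀ) = O * vecMulVec u (S *ᵥ β) * Oᵀ := by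
    rw [vecMulVec_mul, mul_vecMulVec, vecMulVec_mul, vecMul_transpose, hβ, mulVec_mulVec,
      mulVec_mulVec, ← mulVec_transpose]
    simp only [transpose_mul, transpose_transpose, hS, dirichletSecond_isSymm, Matrix.mul_assoc]
  rw [hD, triples, hm.secondMoment_eq hα hO, hm.mean_eq hα hO, hm.thirdMoment_eq hα hO]
  rw [← hS, ← hu, ← hβ, h1, h2, hηu]
  simp only [Matrix.mul_sub, Matrix.sub_mul, Matrix.mul_add, Matrix.add_mul, Matrix.mul_smul,
    Matrix.smul_mul, mul_vecMulVec, vecMulVec_mul, vecMul_transpose]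

end ModifiedMoments

end LDA

namespace LDA

/-! ### Whitening, pseudo-inverses and singular vectors. -/

section LinearAlgebra

variable {d k : ℕ}

/-- Invertibility of the Gram matrix is the form in which linear independence of columns is used
from here on. -/
theorem isUnit_det_gram_of_rank {A : Matrix (Fin d) (Fin k) ℝ} (hA : A.rank = k) :
    IsUnit (Aᵀ * A).det := by
  rw [← Matrix.isUnit_iff_isUnit_det, ← Matrix.mulVec_surjective_iff_isUnit,
    ← Matrix.coe_mulVecLin, ← LinearMap.range_eq_top]
  apply Submodule.eq_top_of_finrank_eq
  rw [← Matrix.rank, Matrix.rank_transpose_mul_self, hA, Module.finrank_fin_fun]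

theorem pinv_mul_self {A : Matrix (Fin d) (Fin k) ℝ} (hA : IsUnit (Aᵀ * A).det) :
    pinv A * A = 1 := by
  rw [pinv, Matrix.mul_assoc, Matrix.nonsing_inv_mul _ hA]

theorem transpose_pinv_mul_transpose (A : Matrix (Fin d) (Fin k) ℝ) :
    (pinv A)ᵀ * Aᵀ = A * pinv A := by
  simp only [pinv, Matrix.transpose_mul, Matrix.transpose_nonsing_inv,
    Matrix.transpose_transpose, Matrix.mul_assoc]

/-- Invertibility of the Gram matrix lets `A` be recovered from `A * Aᵀ` by right multiplication
with `A * (Aᵀ * A)⁻¹`. -/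
theorem range_mulVecLin_mul_transpose {A : Matrix (Fin d) (Fin k) ℝ} (hA : IsUnit (Aᵀ * A).det) :
    LinearMap.range (A * Aᵀ).mulVecLin = LinearMap.range A.mulVecLin := by
  apply le_antisymm
  · rw [Matrix.mulVecLin_mul]
    exact LinearMap.range_comp_le_range _ _
  · have h : A = (A * Aᵀ) * (A * (Aᵀ * A)⁻¹) := by
      rw [Matrix.mul_assoc A, ← Matrix.mul_assoc Aᵀ, Matrix.mul_nonsing_inv _ hA, Matrix.mul_one]
    conv_lhs => rw [h, Matrix.mulVecLin_mul]
    exact LinearMap.range_comp_le_range _ _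

theorem exists_eq_mul_of_range_le {A U : Matrix (Fin d) (Fin k) ℝ}
    (h : LinearMap.range U.mulVecLin ≤ LinearMap.range A.mulVecLin) :
    ∃ Q : Matrix (Fin k) (Fin k) ℝ, U = A * Q := by
  have hc : ∀ j, ∃ v, A *ᵥ v = U.col j := fun j => by
    obtain ⟨v, hv⟩ := h ⟨Pi.single j 1, rfl⟩
    exact ⟨v, by simpa using hv⟩
  choose v hv using hc
  refine ⟨(Matrix.of v)ᵀ, ?_⟩
  ext a j
  exact (congrFun (hv j) a).symm

/-- The columns of `U` and of `A` span the same space; each matrix factors through the other, and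
cancelling `A` shows that the two factors are inverse. -/
theorem IsReduction.exists_eq_mul {A U : Matrix (Fin d) (Fin k) ℝ} (hA : IsUnit (Aᵀ * A).det)
    (hU : IsReduction (A * Aᵀ) U) :
    ∃ Q : Matrix (Fin k) (Fin k) ℝ, IsUnit Q.det ∧ U = A * Q := by
  rw [IsReduction, range_mulVecLin_mul_transpose hA] at hU
  obtain ⟨Q, hQ⟩ := exists_eq_mul_of_range_le hU.le
  obtain ⟨Q', hQ'⟩ := exists_eq_mul_of_range_le hU.ge
  refine ⟨Q, ?_, hQ⟩
  have h : Q * Q' = 1 := by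
    calc Q * Q' = pinv A * A * Q * Q' := by rw [pinv_mul_self hA, Matrix.one_mul]
      _ = pinv A * (A * Q * Q') := by simp only [Matrix.mul_assoc]
      _ = 1 := by rw [← hQ, ← hQ', pinv_mul_self hA]
  exact Matrix.isUnit_det_of_right_inverse h

theorem IsReduction.exists_isWhitening {A U : Matrix (Fin d) (Fin k) ℝ}
    (hA : IsUnit (Aᵀ * A).det) (hU : IsReduction (A * Aᵀ) U) :
    ∃ V, IsWhitening (A * Aᵀ) U V := by
  obtain ⟨Q, hQ, rfl⟩ := hU.exists_eq_mul hA
  have hN : IsUnit (Aᵀ * A * Q).det := by rw [Matrix.det_mul]; exact hA.mul hQ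
  -- This is `(Aᵀ * U)⁻¹`, and `Uᵀ * (A * Aᵀ) * U` is the Gram matrix of `Aᵀ * U`.
  refine ⟨(Aᵀ * A * Q)⁻¹, ?_⟩
  have h : (A * Q)ᵀ * (A * Aᵀ) * (A * Q) = (Aᵀ * A * Q)ᵀ * (Aᵀ * A * Q) := by
    simp only [Matrix.transpose_mul, Matrix.transpose_transpose, Matrix.mul_assoc]
  rw [IsWhitening, h, ← Matrix.mul_assoc, ← Matrix.transpose_mul, Matrix.mul_nonsing_inv _ hN,
    Matrix.transpose_one, Matrix.one_mul, Matrix.mul_nonsing_inv _ hN]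

/-- The whitened matrix `Aᵀ W` is orthogonal. -/
theorem IsWhitening.transpose_mul_self {A U : Matrix (Fin d) (Fin k) ℝ}
    {V : Matrix (Fin k) (Fin k) ℝ} (hV : IsWhitening (A * Aᵀ) U V) :
    (Aᵀ * (U * V))ᵀ * (Aᵀ * (U * V)) = 1 := by
  rw [IsWhitening] at hV
  rw [← hV]
  simp only [Matrix.transpose_mul, Matrix.transpose_transpose, Matrix.mul_assoc]

/-- The factor `C` is invertible because `Aᵀ * A * C = Aᵀ * W` is orthogonal. Thus `W` has the same
range as `A`. -/
theorem IsWhitening.exists_eq_mul {A U : Matrix (Fin d) (Fin k) ℝ}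
    {V : Matrix (Fin k) (Fin k) ℝ} (hA : IsUnit (Aᵀ * A).det) (hU : IsReduction (A * Aᵀ) U)
    (hV : IsWhitening (A * Aᵀ) U V) :
    ∃ C : Matrix (Fin k) (Fin k) ℝ, IsUnit C.det ∧ U * V = A * C := by
  obtain ⟨Q, -, hQ⟩ := hU.exists_eq_mul hA
  refine ⟨Q * V, ?_, by rw [hQ, Matrix.mul_assoc]⟩
  have h := Matrix.isUnit_det_of_left_inverse hV.transpose_mul_self
  rw [hQ, Matrix.mul_assoc A, ← Matrix.mul_assoc, Matrix.det_mul] at h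
  exact isUnit_of_mul_isUnit_right h

theorem IsWhitening.isUnit_det_gram {A U : Matrix (Fin d) (Fin k) ℝ}
    {V : Matrix (Fin k) (Fin k) ℝ} (hA : IsUnit (Aᵀ * A).det) (hU : IsReduction (A * Aᵀ) U)
    (hV : IsWhitening (A * Aᵀ) U V) : IsUnit ((U * V)ᵀ * (U * V)).det := by
  obtain ⟨C, hC, h⟩ := hV.exists_eq_mul hA hU
  have e : (A * C)ᵀ * (A * C) = Cᵀ * (Aᵀ * A) * C := by
    simp only [Matrix.transpose_mul, Matrix.mul_assoc]
  rw [h, e, Matrix.det_mul, Matrix.det_mul, Matrix.det_transpose]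
  exact (hC.mul hA).mul hC

/-- This undoes the whitening: the left side is `W * pinv W * A`, and `W * pinv W` is the orthogonal
projection onto the range of `W`, which is that of `A`. -/
theorem IsWhitening.transpose_pinv_mul {A U : Matrix (Fin d) (Fin k) ℝ}
    {V : Matrix (Fin k) (Fin k) ℝ} (hA : IsUnit (Aᵀ * A).det) (hU : IsReduction (A * Aᵀ) U)
    (hV : IsWhitening (A * Aᵀ) U V) : (pinv (U * V))ᵀ * (Aᵀ * (U * V))ᵀ = A := by
  have hW := hV.isUnit_det_gram hA hU
  obtain ⟨C, hC, h⟩ := hV.exists_eq_mul hA hU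
  have hAW : A = U * V * C⁻¹ := by
    rw [h, Matrix.mul_assoc, Matrix.mul_nonsing_inv _ hC, Matrix.mul_one]
  rw [Matrix.transpose_mul, Matrix.transpose_transpose, ← Matrix.mul_assoc,
    transpose_pinv_mul_transpose]
  conv_lhs => rw [hAW]
  rw [Matrix.mul_assoc, ← Matrix.mul_assoc (pinv (U * V)), pinv_mul_self hW, Matrix.one_mul,
    ← hAW]

/-- A matrix with an orthogonal eigenbasis has a singular value decomposition. -/
theorem exists_isSVD {B : Matrix (Fin k) (Fin k) ℝ} (hB : Bᵀ * B = 1) (t : Fin k → ℝ) :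
    ∃ L s R, IsSVD (Bᵀ * diagonal t * B) L s R := by
  -- Singular values are nonnegative, so the signs of the eigenvalues move to the right factor; the
  -- value `1` at zero keeps that factor orthogonal.
  set σ : Fin k → ℝ := fun i => if 0 ≤ t i then 1 else -1 with hσ
  have hσσ : diagonal σ * diagonal σ = 1 := by
    rw [diagonal_mul_diagonal, ← diagonal_one]
    congr 1
    ext i
    simp only [hσ]
    split_ifs <;> norm_num
  refine ⟨Bᵀ, fun i => |t i|, Bᵀ * diagonal σ, ?_, ?_, fun i => abs_nonneg _, ?_⟩
  · rw [Matrix.mem_orthogonalGroup_iff, Matrix.transpose_transpose, hB]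
  · rw [Matrix.mem_orthogonalGroup_iff, Matrix.transpose_mul, diagonal_transpose,
      Matrix.transpose_transpose, Matrix.mul_assoc, ← Matrix.mul_assoc (diagonal σ), hσσ,
      Matrix.one_mul, hB]
  · rw [Matrix.transpose_mul, diagonal_transpose, Matrix.transpose_transpose, ← Matrix.mul_assoc,
      Matrix.mul_assoc Bᵀ (diagonal fun i => |t i|), diagonal_mul_diagonal]
    congr 3
    ext i
    simp only [hσ]
    split_ifs with h
    · rw [abs_of_nonneg h, mul_one]
    · rw [abs_of_neg (not_le.1 h)]; ring

variable {B L R : Matrix (Fin k) (Fin k) ℝ} {s t : Fin k → ℝ}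

theorem IsSVD.transpose_mul_left {A : Matrix (Fin k) (Fin k) ℝ} (h : IsSVD A L s R) :
    Lᵀ * L = 1 :=
  (Matrix.mem_orthogonalGroup_iff' _ _).1 h.left_orthogonal

theorem IsSVD.transpose_mul_right {A : Matrix (Fin k) (Fin k) ℝ} (h : IsSVD A L s R) :
    Rᵀ * R = 1 :=
  (Matrix.mem_orthogonalGroup_iff' _ _).1 h.right_orthogonal

/-- The change of basis between an orthogonal eigenbasis and the left singular vectors relates
equal squares of eigenvalues and singular values only. -/
theorem IsSVD.sq_eq_sq (hB : Bᵀ * B = 1) (h : IsSVD (Bᵀ * diagonal t * B) L s R) {i j : Fin k}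
    (hij : (B * L) i j ≠ 0) : t i ^ 2 = s j ^ 2 := by
  have hB' : B * Bᵀ = 1 := mul_eq_one_comm.1 hB
  have e1 : (Bᵀ * diagonal t * B) * (Bᵀ * diagonal t * B)ᵀ =
      Bᵀ * (diagonal t * diagonal t) * B := by
    calc _ = Bᵀ * diagonal t * (B * Bᵀ) * diagonal t * B := by
          simp only [Matrix.transpose_mul, diagonal_transpose, Matrix.transpose_transpose,
            Matrix.mul_assoc]
      _ = _ := by rw [hB', Matrix.mul_one]; simp only [Matrix.mul_assoc]
  have e2 : (Bᵀ * diagonal t * B) * (Bᵀ * diagonal t * B)ᵀ =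
      L * (diagonal s * diagonal s) * Lᵀ := by
    calc _ = L * diagonal s * (Rᵀ * R) * diagonal s * Lᵀ := by
          rw [h.eq]
          simp only [Matrix.transpose_mul, diagonal_transpose, Matrix.transpose_transpose,
            Matrix.mul_assoc]
      _ = _ := by rw [h.transpose_mul_right, Matrix.mul_one]; simp only [Matrix.mul_assoc]
  -- Both expressions for the matrix times its transpose agree, so `B * L` intertwines the squared
  -- eigenvalues with the squared singular values.
  have e3 : (diagonal t * diagonal t) * (B * L) = (B * L) * (diagonal s * diagonal s) := by
    calc _ = B * Bᵀ * (diagonal t * diagonal t) * (B * L) := by rw [hB', Matrix.one_mul]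
      _ = B * (Bᵀ * (diagonal t * diagonal t) * B) * L := by simp only [Matrix.mul_assoc]
      _ = B * L * (diagonal s * diagonal s) * (Lᵀ * L) := by
          rw [← e1, e2]; simp only [Matrix.mul_assoc]
      _ = _ := by rw [h.transpose_mul_left, Matrix.mul_one]
  have e4 := congrFun (congrFun e3 i) j
  rw [diagonal_mul_diagonal, diagonal_mul_diagonal, diagonal_mul, mul_diagonal, mul_comm] at e4
  have := mul_left_cancel₀ hij e4
  rw [sq, sq, this]

theorem exists_ne_zero_of_mul_eq_one {G H : Matrix (Fin k) (Fin k) ℝ} (h : G * H = 1)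
    (i : Fin k) : ∃ j, G i j ≠ 0 := by
  by_contra! hc
  have := congrFun (congrFun h i) i
  simp [Matrix.mul_apply, hc] at this

/-- A left singular vector with a unique singular value is proportional to a vector of any
orthogonal eigenbasis. -/
theorem IsSVD.exists_col_eq_smul (hB : Bᵀ * B = 1) (h : IsSVD (Bᵀ * diagonal t * B) L s R)
    {j : Fin k} (hj : ∀ j', s j' = s j → j' = j) :
    ∃ i, ∃ ε : ℝ, ε ≠ 0 ∧ L.col j = ε • Bᵀ.col i ∧ t i ^ 2 = s j ^ 2 := by
  have hG : (B * L)ᵀ * (B * L) = 1 := by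
    rw [Matrix.transpose_mul, Matrix.mul_assoc, ← Matrix.mul_assoc Bᵀ, hB, Matrix.one_mul,
      h.transpose_mul_left]
  have hG' : (B * L) * (B * L)ᵀ = 1 := mul_eq_one_comm.1 hG
  obtain ⟨i, hi⟩ := exists_ne_zero_of_mul_eq_one hG j
  rw [Matrix.transpose_apply] at hi
  -- A nonzero entry of row `i` at `j'` would force `s j' = s j`, so simplicity leaves only the
  -- entry at `j`.
  have hrow : ∀ j', j' ≠ j → (B * L) i j' = 0 := fun j' hj' => by
    by_contra hne
    refine hj' (hj j' ?_)
    rw [← sq_eq_sq₀ (h.nonneg _) (h.nonneg _), ← h.sq_eq_sq hB hne, ← h.sq_eq_sq hB hi]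
  -- The other rows of the orthogonal matrix `B * L` are orthogonal to row `i`, a nonzero multiple
  -- of a basis vector, so column `j` is supported at `i`.
  have hcol : ∀ i', i' ≠ i → (B * L) i' j = 0 := fun i' hi' => by
    have e := congrFun (congrFun hG' i') i
    rw [Matrix.mul_apply, Finset.sum_eq_single j (fun j' _ hj' => by
      rw [Matrix.transpose_apply, hrow j' hj', mul_zero]) (by simp), Matrix.transpose_apply,
      Matrix.one_apply_ne hi'] at e
    exact (mul_eq_zero.1 e).resolve_right hi
  refine ⟨i, (B * L) i j, hi, ?_, h.sq_eq_sq hB hi⟩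
  have hL : L = Bᵀ * (B * L) := by rw [← Matrix.mul_assoc, hB, Matrix.one_mul]
  ext a
  calc L a j = (Bᵀ * (B * L)) a j := by rw [← hL]
    _ = Bᵀ a i * (B * L) i j := by
      rw [Matrix.mul_apply]
      exact Finset.sum_eq_single i (fun i' _ hi' => by rw [hcol i' hi', mul_zero]) (by simp)
    _ = _ := mul_comm _ _

/-- If the squares of the eigenvalues are distinct, every eigenvector is proportional to a left
singular vector with a unique singular value. -/
theorem IsSVD.exists_unique_col_eq_smul (hB : Bᵀ * B = 1)
    (h : IsSVD (Bᵀ * diagonal t * B) L s R) (ht : Function.Injective fun i => t i ^ 2)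
    (i : Fin k) :
    ∃ j, (∀ j', s j' = s j → j' = j) ∧ ∃ ε : ℝ, ε ≠ 0 ∧ L.col j = ε • Bᵀ.col i := by
  have hG' : (B * L) * (B * L)ᵀ = 1 := by
    rw [mul_eq_one_comm, Matrix.transpose_mul, Matrix.mul_assoc, ← Matrix.mul_assoc Bᵀ, hB,
      Matrix.one_mul, h.transpose_mul_left]
  -- Matching each eigenvalue with a singular value is injective because the squares `t i ^ 2`
  -- differ, hence bijective by finiteness; so every singular value is simple.
  choose σ hσ using exists_ne_zero_of_mul_eq_one hG'
  have hts : ∀ i, t i ^ 2 = s (σ i) ^ 2 := fun i => h.sq_eq_sq hB (hσ i)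
  have hinj : Function.Injective σ := fun a b hab => ht (by
    simp only [hts, hab])
  have hsurj : Function.Surjective σ := Finite.surjective_of_injective hinj
  have huniq : ∀ j', s j' = s (σ i) → j' = σ i := fun j' hj' => by
    obtain ⟨i', rfl⟩ := hsurj j'
    rw [ht (a₁ := i') (a₂ := i) (by simp only [hts, hj'])]
  obtain ⟨i', ε, hε, hcol, hi'⟩ := h.exists_col_eq_smul hB huniq
  rw [← hts i] at hi'
  obtain rfl := ht hi'
  exact ⟨_, huniq, ε, hε, hcol⟩

end LinearAlgebra

/-! ### Null sets on the sphere. -/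

section Sphere

/-- The spherical measure of a set is proportional to the volume of the cone over it; here the cone
lies in a hyperplane. -/
theorem ae_uniformSphere_dotProduct_ne_zero {k : ℕ} {c : Fin k → ℝ} (hc : c ≠ 0) :
    ∀ᵐ θ ∂(uniformSphere k), c ⬝ᵥ θ.1.ofLp ≠ 0 := by
  refine Measure.ae_smul_measure ?_ _
  set φ : EuclideanSpace ℝ (Fin k) →L[ℝ] ℝ := innerSL ℝ (WithLp.toLp 2 c) with hφ
  have hφc : ∀ x : EuclideanSpace ℝ (Fin k), φ x = c ⬝ᵥ x.ofLp := fun x => by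
    simp [hφ, EuclideanSpace.inner_eq_star_dotProduct, dotProduct_comm]
  have hs : MeasurableSet {θ : Metric.sphere (0 : EuclideanSpace ℝ (Fin k)) 1 | φ θ.1 = 0} :=
    (isClosed_eq (by fun_prop) continuous_const).measurableSet
  have hker : LinearMap.ker φ.toLinearMap ≠ ⊤ := fun htop => by
    have h0 : φ (WithLp.toLp 2 c) = 0 := LinearMap.mem_ker.1 (htop ▸ Submodule.mem_top)
    rw [hφc] at h0
    exact hc (dotProduct_self_eq_zero.1 h0)
  rw [ae_iff]
  simp only [not_not, ← hφc]
  rw [Measure.toSphere_apply' _ hs]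
  refine mul_eq_zero_of_right _ (measure_mono_null ?_ (Measure.addHaar_submodule volume _ hker))
  rintro _ ⟨r, -, _, ⟨θ, hθ, rfl⟩, rfl⟩
  have h0 : φ θ.1 = 0 := hθ
  simp [h0]

end Sphere

end LDA

namespace LDA

/-! ### Recovery of topics from singular vectors. -/

section Recovery

variable {d k : ℕ} {A O U : Matrix (Fin d) (Fin k) ℝ} {V : Matrix (Fin k) (Fin k) ℝ}
  {κ δ : Fin k → ℝ}

theorem whitenedTriples_eq {Triples : (Fin d → ℝ) → Matrix (Fin d) (Fin d) ℝ}
    (hT : ∀ η, Triples η = A * diagonal (fun i => κ i * (Aᵀ *ᵥ η) i) * Aᵀ)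
    (W : Matrix (Fin d) (Fin k) ℝ) (θ : Fin k → ℝ) :
    whitenedTriples Triples W θ =
      (Aᵀ * W)ᵀ * diagonal (fun i => κ i * ((Aᵀ * W) *ᵥ θ) i) * (Aᵀ * W) := by
  rw [whitenedTriples, hT, mulVec_mulVec]
  simp only [Matrix.transpose_mul, Matrix.transpose_transpose, Matrix.mul_assoc]

theorem transpose_pinv_mulVec_smul_col (hA : IsUnit (Aᵀ * A).det) (hU : IsReduction (A * Aᵀ) U)
    (hV : IsWhitening (A * Aᵀ) U V) (hAO : ∀ i, A.col i = δ i • O.col i) (ε : ℝ) (i : Fin k) :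
    (pinv (U * V))ᵀ *ᵥ (ε • (Aᵀ * (U * V))ᵀ.col i) = (ε * δ i) • O.col i := by
  have h : (pinv (U * V))ᵀ *ᵥ (Aᵀ * (U * V))ᵀ.col i = A.col i := by
    conv_rhs => rw [← hV.transpose_pinv_mul hA hU]
    rfl
  rw [mulVec_smul, h, hAO, smul_smul]

theorem one_dotProduct_smul_col (hO : ∀ i, O.col i ∈ stdSimplex ℝ (Fin d)) (r : ℝ) (i : Fin k) :
    (1 : Fin d → ℝ) ⬝ᵥ (r • O.col i) = r := by
  rw [dotProduct_smul, one_dotProduct, (hO i).2, smul_eq_mul, mul_one]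

theorem normalize_smul_col (hO : ∀ i, O.col i ∈ stdSimplex ℝ (Fin d)) {r : ℝ} (hr : r ≠ 0)
    (i : Fin k) : ((1 : Fin d → ℝ) ⬝ᵥ (r • O.col i))⁻¹ • (r • O.col i) = O.col i := by
  rw [one_dotProduct_smul_col hO, inv_smul_smul₀ hr]

/-- A coincidence of squares puts `θ` on a hyperplane with normal `κ i • B.row i ± κ j • B.row j`.
The normal is nonzero by orthonormality of the rows, and there are finitely many such hyperplanes.
-/
theorem ae_uniformSphere_injective_sq {B : Matrix (Fin k) (Fin k) ℝ} (hB : Bᵀ * B = 1)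
    (hκ : ∀ i, κ i ≠ 0) :
    ∀ᵐ θ ∂(uniformSphere k), Function.Injective fun i => (κ i * (B *ᵥ θ.1.ofLp) i) ^ 2 := by
  have hB' : B * Bᵀ = 1 := mul_eq_one_comm.1 hB
  have hne : ∀ i j, i ≠ j → ∀ r : ℝ, κ i • B.row i + r • B.row j ≠ 0 := fun i j hij r h0 => by
    have h1 : B i ⬝ᵥ (κ i • B.row i + r • B.row j) = κ i := by
      rw [dotProduct_add, dotProduct_smul, dotProduct_smul]
      have e1 : B i ⬝ᵥ B.row i = 1 := by
        have := congrFun (congrFun hB' i) i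
        rwa [Matrix.one_apply_eq] at this
      have e2 : B i ⬝ᵥ B.row j = 0 := by
        have := congrFun (congrFun hB' i) j
        rwa [Matrix.one_apply_ne hij] at this
      rw [e1, e2]
      simp
    rw [h0, dotProduct_zero] at h1
    exact hκ i h1.symm
  have hae : ∀ i j, i ≠ j → ∀ r : ℝ, ∀ᵐ θ ∂(uniformSphere k),
      κ i * (B *ᵥ θ.1.ofLp) i + r * (B *ᵥ θ.1.ofLp) j ≠ 0 := fun i j hij r => by
    filter_upwards [ae_uniformSphere_dotProduct_ne_zero (hne i j hij r)] with θ hθ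
    rw [add_dotProduct, smul_dotProduct, smul_dotProduct] at hθ
    exact hθ
  have hall : ∀ᵐ θ ∂(uniformSphere k), ∀ i j, i ≠ j →
      κ i * (B *ᵥ θ.1.ofLp) i + κ j * (B *ᵥ θ.1.ofLp) j ≠ 0 ∧
      κ i * (B *ᵥ θ.1.ofLp) i + -κ j * (B *ᵥ θ.1.ofLp) j ≠ 0 := by
    simp only [ae_all_iff]
    exact fun i j hij => (hae i j hij _).and (hae i j hij _)
  filter_upwards [hall] with θ hθ i j hij
  by_contra hne
  obtain ⟨h1, h2⟩ := hθ i j hne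
  rcases sq_eq_sq_iff_eq_or_eq_neg.1 hij with h | h
  · exact h2 (by rw [h]; ring)
  · exact h1 (by rw [h]; ring)

end Recovery

end LDA

/-! ### Assembly of the main theorem. -/

theorem theorem3 {Ω : Type*} [MeasurableSpace Ω] (P : Measure Ω) [IsProbabilityMeasure P]
    {d k : ℕ} (α : Fin k → ℝ) (hα : ∀ i, 0 < α i) (α₀ : ℝ) (hα₀ : α₀ = ∑ i, α i)
    (O : Matrix (Fin d) (Fin k) ℝ) (hO : ∀ i, O.col i ∈ stdSimplex ℝ (Fin d))
    (hrank : O.rank = k)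
    (h : Ω → Fin k → ℝ) (z : ℕ → Ω → Fin k) (w : ℕ → Ω → Fin d)
    (hmodel : LDA.IsModel P α O h z w)
    (Pairs : Matrix (Fin d) (Fin d) ℝ) (hPairs : Pairs = LDA.pairs P (LDA.oneHot w) α₀)
    (Triples : (Fin d → ℝ) → Matrix (Fin d) (Fin d) ℝ)
    (hTriples : Triples = LDA.triples P (LDA.oneHot w) α₀) :
    -- every step of the algorithm can be carried out
    ((∃ U : Matrix (Fin d) (Fin k) ℝ, LDA.IsReduction Pairs U) ∧
      ∀ U : Matrix (Fin d) (Fin k) ℝ, LDA.IsReduction Pairs U →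
        (∃ V, LDA.IsWhitening Pairs U V) ∧
        ∀ V, LDA.IsWhitening Pairs U V →
          IsUnit ((U * V)ᵀ * (U * V)).det ∧
          ∀ θ : Fin k → ℝ,
            (∃ L s R, LDA.IsSVD (LDA.whitenedTriples Triples (U * V) θ) L s R) ∧
            ∀ L s R, LDA.IsSVD (LDA.whitenedTriples Triples (U * V) θ) L s R →
              ∀ l ∈ LDA.uniqueSingularVectors L s,
                (1 : Fin d → ℝ) ⬝ᵥ ((LDA.pinv (U * V))ᵀ *ᵥ l) ≠ 0) ∧
    -- no false positives
    (∀ (U : Matrix (Fin d) (Fin k) ℝ) (V : Matrix (Fin k) (Fin k) ℝ),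
      LDA.IsReduction Pairs U → LDA.IsWhitening Pairs U V →
        ∀ θ : Fin k → ℝ, ∀ L s R,
          LDA.IsSVD (LDA.whitenedTriples Triples (U * V) θ) L s R →
            LDA.output (U * V) L s ⊆ Set.range O.col) ∧
    -- topic recovery
    (∀ (U : Matrix (Fin d) (Fin k) ℝ) (V : Matrix (Fin k) (Fin k) ℝ),
      LDA.IsReduction Pairs U → LDA.IsWhitening Pairs U V →
        ∀ᵐ θ ∂(LDA.uniformSphere k), ∀ L s R,
          LDA.IsSVD (LDA.whitenedTriples Triples (U * V) θ.1.ofLp) L s R →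
            LDA.output (U * V) L s = Set.range O.col) ∧
    -- parameter recovery
    α = (α₀ * (α₀ + 1)) • ((LDA.pinv O * Pairs * (LDA.pinv O)ᵀ) *ᵥ (1 : Fin k → ℝ)) := by
  have hO0 : ∀ a i, 0 ≤ O a i := fun a i => (hO i).1 a
  have hOdet := LDA.isUnit_det_gram_of_rank hrank
  -- An index is required because the sum is `0` when `k = 0`.
  have hpos : ∀ _ : Fin k, 0 < α₀ := fun i => by
    rw [hα₀]; exact Finset.sum_pos (fun i _ => hα i) ⟨i, Finset.mem_univ i⟩
  have hP : Pairs = O * diagonal (fun i => α i / (α₀ * (α₀ + 1))) * Oᵀ := by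
    rw [hPairs, hα₀, hmodel.pairs_eq hα hO0]
  set δ : Fin k → ℝ := fun i => √(α i / (α₀ * (α₀ + 1))) with hδ
  have hδpos : ∀ i, 0 < δ i := fun i => by
    have := hα i
    have := hpos i
    exact Real.sqrt_pos.2 (by positivity)
  set A := O * diagonal δ with hAdef
  have hPA : Pairs = A * Aᵀ := by
    rw [hP, hAdef, Matrix.transpose_mul, diagonal_transpose, Matrix.mul_assoc O (diagonal δ),
      ← Matrix.mul_assoc (diagonal δ), diagonal_mul_diagonal, ← Matrix.mul_assoc]
    congr 3
    ext i
    have := hα i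
    have := hpos i
    exact (Real.mul_self_sqrt (by positivity)).symm
  have hA : IsUnit (Aᵀ * A).det := by
    have e : Aᵀ * A = diagonal δ * (Oᵀ * O) * diagonal δ := by
      simp only [hAdef, Matrix.transpose_mul, diagonal_transpose, Matrix.mul_assoc]
    have hδdet : IsUnit (diagonal δ).det := by
      rw [det_diagonal]
      exact (Finset.prod_pos fun i _ => hδpos i).ne'.isUnit
    rw [e, Matrix.det_mul, Matrix.det_mul]
    exact (hδdet.mul hOdet).mul hδdet
  have hAO : ∀ i, A.col i = δ i • O.col i := fun i => by
    ext a
    simp [hAdef, mul_comm]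
  -- Replacing `O` by `A = O * diagonal δ` introduces `δ i` three times: in both outer factors and
  -- in `Aᵀ *ᵥ η`. Hence the division by `δ i ^ 3`.
  set κ : Fin k → ℝ := fun i => 2 * α i / (α₀ * (α₀ + 1) * (α₀ + 2)) / δ i ^ 3 with hκdef
  have hκ : ∀ i, κ i ≠ 0 := fun i => by
    have := hα i
    have := hpos i
    have := hδpos i
    simp only [hκdef]
    positivity
  have hT : ∀ η, Triples η = A * diagonal (fun i => κ i * (Aᵀ *ᵥ η) i) * Aᵀ := fun η => by
    have e : diagonal δ * diagonal (fun i => κ i * (Aᵀ *ᵥ η) i) * diagonal δ =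
        diagonal (fun i => 2 * α i * (Oᵀ *ᵥ η) i / (α₀ * (α₀ + 1) * (α₀ + 2))) := by
      rw [diagonal_mul_diagonal, diagonal_mul_diagonal]
      congr 1
      ext i
      have := hpos i
      have := hδpos i
      rw [hAdef, Matrix.transpose_mul, diagonal_transpose, ← mulVec_mulVec, mulVec_diagonal]
      simp only [hκdef]
      field_simp
    rw [hTriples, hα₀, hmodel.triples_eq hα hO0, ← hα₀, ← e, hAdef, Matrix.transpose_mul,
      diagonal_transpose]
    simp only [Matrix.mul_assoc]
  -- The common source of nonzero denominators and of the absence of false positives: `r` is both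
  -- the denominator and the scalar to be removed.
  have hsub : ∀ (U : Matrix (Fin d) (Fin k) ℝ) (V : Matrix (Fin k) (Fin k) ℝ),
      LDA.IsReduction Pairs U → LDA.IsWhitening Pairs U V → ∀ θ : Fin k → ℝ, ∀ L s R,
        LDA.IsSVD (LDA.whitenedTriples Triples (U * V) θ) L s R →
          ∀ l ∈ LDA.uniqueSingularVectors L s, ∃ i, ∃ r : ℝ, r ≠ 0 ∧
            (LDA.pinv (U * V))ᵀ *ᵥ l = r • O.col i := by
    rintro U V hU hV θ L s R hsvd _ ⟨j, rfl, hj⟩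
    rw [hPA] at hU hV
    rw [LDA.whitenedTriples_eq hT] at hsvd
    obtain ⟨i, ε, hε, hcol, -⟩ := hsvd.exists_col_eq_smul hV.transpose_mul_self hj
    exact ⟨i, ε * δ i, mul_ne_zero hε (hδpos i).ne', by
      rw [hcol, LDA.transpose_pinv_mulVec_smul_col hA hU hV hAO]⟩
  have hfalse : ∀ (U : Matrix (Fin d) (Fin k) ℝ) (V : Matrix (Fin k) (Fin k) ℝ),
      LDA.IsReduction Pairs U → LDA.IsWhitening Pairs U V → ∀ θ : Fin k → ℝ, ∀ L s R,
        LDA.IsSVD (LDA.whitenedTriples Triples (U * V) θ) L s R →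
          LDA.output (U * V) L s ⊆ Set.range O.col := by
    rintro U V hU hV θ L s R hsvd _ ⟨l, hl, rfl⟩
    obtain ⟨i, r, hr, e⟩ := hsub U V hU hV θ L s R hsvd l hl
    exact ⟨i, by simp only [e, LDA.normalize_smul_col hO hr]⟩
  -- `A` itself serves as a reduction, having the same range as `A * Aᵀ`.
  refine ⟨⟨⟨A, ?_⟩, fun U hU => ⟨?_, fun V hV => ⟨?_, fun θ => ⟨?_, ?_⟩⟩⟩⟩, hfalse, ?_, ?_⟩
  · rw [LDA.IsReduction, hPA, LDA.range_mulVecLin_mul_transpose hA]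
  · rw [hPA] at hU ⊢
    exact hU.exists_isWhitening hA
  · rw [hPA] at hU hV
    exact hV.isUnit_det_gram hA hU
  · rw [hPA] at hV
    rw [LDA.whitenedTriples_eq hT]
    exact LDA.exists_isSVD hV.transpose_mul_self _
  · intro L s R hsvd l hl
    obtain ⟨i, r, hr, e⟩ := hsub U V hU hV θ L s R hsvd l hl
    rwa [e, LDA.one_dotProduct_smul_col hO]
  · intro U V hU hV
    have hV' := hV
    have hU' := hU
    rw [hPA] at hV' hU'
    filter_upwards [LDA.ae_uniformSphere_injective_sq hV'.transpose_mul_self hκ]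
      with θ hθ L s R hsvd
    refine (hfalse U V hU hV _ L s R hsvd).antisymm ?_
    rintro _ ⟨i, rfl⟩
    rw [LDA.whitenedTriples_eq hT] at hsvd
    obtain ⟨j, hj, ε, hε, hcol⟩ := hsvd.exists_unique_col_eq_smul hV'.transpose_mul_self hθ i
    refine ⟨L.col j, ⟨j, rfl, hj⟩, ?_⟩
    simp only [hcol, LDA.transpose_pinv_mulVec_smul_col hA hU' hV' hAO,
      LDA.normalize_smul_col hO (mul_ne_zero hε (hδpos i).ne')]
  · have e : LDA.pinv O * Pairs * (LDA.pinv O)ᵀ =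
        diagonal (fun i => α i / (α₀ * (α₀ + 1))) := by
      calc _ = (LDA.pinv O * O) * diagonal (fun i => α i / (α₀ * (α₀ + 1))) *
            (LDA.pinv O * O)ᵀ := by
            rw [hP]; simp only [Matrix.transpose_mul, Matrix.mul_assoc]
        _ = _ := by
            rw [LDA.pinv_mul_self hOdet, Matrix.transpose_one, Matrix.one_mul, Matrix.mul_one]
    ext i
    have := hpos i
    rw [e, Pi.smul_apply, mulVec_diagonal, Pi.one_apply, mul_one, smul_eq_mul]
    field_simp
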